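/- For a finite tree $T$ and $n\ge 0$, let $\mathrm{ex}^c(n,T)$ be the maximum number of edges in an $n$-vertex simple graph $G$ that admits a proper vertex coloring (with any number of colors) such that, in every (not necessarily induced) copy of $T$ in $G$, all leaves of $T$ receive the same color. Here a leaf is a vertex of degree $1$. **Theorem.** Let $T$ be a finite tree with at least one edge such that in the proper vertex $2$-coloring of $T$ (unique up to exchanging the two colors) all leaves have the same color. Then there is $N=N(T)$ such that for all $n\ge N$, $$\mathrm{ex}^c(n,T)=\left\lfloor \frac{n^2}{4}\right\rfloor .$$ Moreover, for these $n$ the maximum is attained by the complete bipartite graph $K_{\lfloor n/2\rfloor,\lceil n/2\rceil}$: it has $\lfloor n^2/4\rfloor$ edges and admits a proper vertex coloring such that in every copy of $T$ in it all leaves of $T$ receive the same color. -/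

import Mathlib

/-- A leaf of a graph is a vertex with exactly one neighbour. -/
def SimpleGraph.IsLeafVertex {V : Type*} (T : SimpleGraph V) (v : V) : Prop :=
  (T.neighborSet v).ncard = 1

/-- All leaves of `T` receive the same color in every copy of `T` in the colored graph `G`
(copies are subgraphs, not necessarily induced). -/
def SimpleGraph.LeavesSameColor {V W α : Type*} (T : SimpleGraph V) (G : SimpleGraph W)
    (c : G.Coloring α) : Prop :=
  ∀ f : SimpleGraph.Copy T G, ∀ u v : V,
    T.IsLeafVertex u → T.IsLeafVertex v → c (f u) = c (f v)

/-- The possible numbers of edges of an `n`-vertex graph that has a proper vertex coloring, with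
any number of colors, such that in every copy of `T` all leaves of `T` have the same color. -/
def SimpleGraph.coloredEdgeCounts {V : Type*} (n : ℕ) (T : SimpleGraph V) : Set ℕ :=
  {m | ∃ (G : SimpleGraph (Fin n)) (c : G.Coloring ℕ),
    T.LeavesSameColor G c ∧ G.edgeSet.ncard = m}

/-- The colored extremal number `ex^c(n, T)`: the maximum of the above edge counts. -/
noncomputable def SimpleGraph.coloredExtremalNumber {V : Type*} (n : ℕ) (T : SimpleGraph V) : ℕ :=
  sSup (T.coloredEdgeCounts n)

/-- The supremum in the definition of `ex^c(n, T)` is always a maximum. -/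
theorem SimpleGraph.isGreatest_coloredExtremalNumber {V : Type*} (n : ℕ) (T : SimpleGraph V) :
    IsGreatest (T.coloredEdgeCounts n) (T.coloredExtremalNumber n) := by
  have hb : BddAbove (T.coloredEdgeCounts n) := by
    refine ⟨(Set.univ : Set (Sym2 (Fin n))).ncard, ?_⟩
    rintro m ⟨G, c, -, rfl⟩
    exact Set.ncard_le_ncard (Set.subset_univ _) Set.finite_univ
  have hne : (T.coloredEdgeCounts n).Nonempty := by
    refine ⟨_, ⊥, SimpleGraph.Coloring.mk (fun _ => 0) (by simp), ?_, rfl⟩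
    intro f u v _ _
    rfl
  exact ⟨Nat.sSup_mem hne hb, fun m hm => le_csSup hb hm⟩

/-! The upper bound is a progressive induction: deleting vertices of degree below `⌊n/2⌋` lowers the
excess of the edge count over `⌊n²/4⌋`, so it suffices to treat large graphs of minimum degree at
least `⌊n/2⌋` and show that they are bipartite (`LeavesSameColor.isBipartite`). There, trees embed
greedily. Moving one leaf of a copy while another leaf stays fixed shows that each vertex sees
almost only one color, which yields two color classes of nearly `n/2` vertices each. A vertex of a
third color with many neighbours in one class could serve as a leaf of a copy whose other leaves lie
in the opposite class; hence it has few neighbours in both, against the degree condition. The lower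
bound colors the complete bipartite graph by its two sides. -/

namespace SimpleGraph

/-! ### Embedding trees and finding leaves -/

/-- Greedy embedding of a rooted tree: each vertex `v` of the tree goes to the prescribed set `S v`,
provided that every admissible image of a parent has enough neighbours that are admissible for the
child. -/
theorem IsTree.exists_copy_of_le_ncard_neighborSet_inter {W : Type*} [Finite W]
    {G : SimpleGraph W} {k : ℕ} {V : Type*} [Finite V] {T : SimpleGraph V} (hT : T.IsTree)
    (a : V) (S : V → Set W) (w₀ : W) (hw₀ : w₀ ∈ S a) (hk : Nat.card V ≤ k)
    (h : ∀ v v', T.Adj v v' → v' ≠ a → ∀ w ∈ S v, k ≤ (G.neighborSet w ∩ S v').ncard) :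
    ∃ f : Copy T G, f a = w₀ ∧ ∀ v, f v ∈ S v := by
  classical
  induction hn : Nat.card V generalizing V with
  | zero => exact absurd hn (Nat.card_pos_iff.2 ⟨⟨a⟩, inferInstance⟩).ne'
  | succ n ih =>
    have := Fintype.ofFinite V
    rcases subsingleton_or_nontrivial V with hV | hV
    · have hadj : ∀ u v, ¬ T.Adj u v := fun u v huv => huv.ne (Subsingleton.elim _ _)
      refine ⟨⟨⟨fun _ => w₀, fun {u v} huv => (hadj u v huv).elim⟩,
        fun _ _ _ => Subsingleton.elim _ _⟩, rfl, fun v => ?_⟩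
      rwa [Subsingleton.elim v a]
    · obtain ⟨l, hla, hl⟩ : ∃ l, l ≠ a ∧ T.degree l = 1 := by
        obtain ⟨u, v, huv, hu, hv⟩ := hT.exists_ne_and_degree_eq_one
        by_cases hua : u = a
        · exact ⟨v, fun hva => huv (hua.trans hva.symm), hv⟩
        · exact ⟨u, hua, hu⟩
      obtain ⟨p, hlp, hp⟩ := degree_eq_one_iff_existsUnique_adj.mp hl
      have hT' : (T.induce {l}ᶜ).IsTree :=
        ⟨hT.connected.induce_compl_singleton_of_degree_eq_one hl, hT.isAcyclic.induce _⟩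
      have hcard : Nat.card ({l}ᶜ : Set V) = n := by
        have := Set.ncard_add_ncard_compl ({l} : Set V)
        rw [Set.ncard_singleton, hn] at this
        rw [Nat.card_coe_set_eq]; omega
      obtain ⟨f, hfa, hfS⟩ := ih hT' ⟨a, fun h => hla h.symm⟩ (fun v => S v) hw₀
        (by omega) (fun v v' hvv' hne w hw => h v v' hvv' (fun e => hne (Subtype.ext e)) w hw)
        hcard
      have hpl : p ≠ l := hlp.ne'
      -- The copy of `T` minus `l` occupies at most `|V| - 1 < k` vertices, so the image of `p` has
      -- an unused neighbour in `S l`.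
      have hrange : (Set.range f).ncard < (G.neighborSet (f ⟨p, hpl⟩) ∩ S l).ncard := by
        calc (Set.range f).ncard ≤ Nat.card ({l}ᶜ : Set V) := by
              rw [← Set.image_univ, ← Set.ncard_univ]; exact Set.ncard_image_le
          _ < k := by omega
          _ ≤ _ := h p l hlp.symm hla _ (hfS ⟨p, hpl⟩)
      obtain ⟨w, ⟨hwadj, hwS⟩, hwf⟩ := Set.exists_mem_notMem_of_ncard_lt_ncard hrange
      let g : V → W := fun v => if hv : v = l then w else f ⟨v, hv⟩
      have gl : g l = w := dif_pos rfl
      have gne : ∀ v (hv : v ≠ l), g v = f ⟨v, hv⟩ := fun v hv => dif_neg hv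
      have hinj : Function.Injective g := by
        intro u v huv
        by_cases hu : u = l <;> by_cases hv : v = l
        · rw [hu, hv]
        · rw [hu, gl, gne v hv] at huv
          exact (hwf ⟨_, huv.symm⟩).elim
        · rw [hv, gl, gne u hu] at huv
          exact (hwf ⟨_, huv⟩).elim
        · rw [gne u hu, gne v hv] at huv
          exact congrArg Subtype.val (f.injective huv)
      have hhom : ∀ {u v}, T.Adj u v → G.Adj (g u) (g v) := by
        intro u v huv
        by_cases hu : u = l <;> by_cases hv : v = l
        · exact (huv.ne (hu.trans hv.symm)).elim
        · subst hu
          obtain rfl := hp v huv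
          rw [gl, gne v hv]
          exact G.adj_symm hwadj
        · subst hv
          obtain rfl := hp u huv.symm
          rw [gl, gne u hu]
          exact hwadj
        · rw [gne u hu, gne v hv]
          exact f.toHom.map_adj (v := ⟨u, hu⟩) (w := ⟨v, hv⟩) huv
      refine ⟨⟨⟨g, hhom⟩, hinj⟩, (gne a hla.symm).trans hfa, fun v => ?_⟩
      change g v ∈ S v
      by_cases hv : v = l
      · rw [hv, gl]; exact hwS
      · rw [gne v hv]; exact hfS ⟨v, hv⟩

/-- A nontrivial finite tree has two distinct leaves. -/
theorem IsTree.exists_ne_isLeafVertex {V : Type*} [Finite V] [Nontrivial V] {T : SimpleGraph V}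
    (hT : T.IsTree) : ∃ u v, u ≠ v ∧ T.IsLeafVertex u ∧ T.IsLeafVertex v := by
  classical
  have := Fintype.ofFinite V
  obtain ⟨u, v, huv, hu, hv⟩ := hT.exists_ne_and_degree_eq_one
  refine ⟨u, v, huv, ?_, ?_⟩
  · rwa [IsLeafVertex, ← Nat.card_coe_set_eq, Nat.card_eq_fintype_card, card_neighborSet_eq_degree]
  · rwa [IsLeafVertex, ← Nat.card_coe_set_eq, Nat.card_eq_fintype_card, card_neighborSet_eq_degree]

/-! ### Large minimum degree forces bipartiteness -/

section MinDegree

variable {V W α : Type*} [Finite V] [Finite W] {T : SimpleGraph V} {G : SimpleGraph W}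
  {c : G.Coloring α}

/-- If all degrees are large, then almost all neighbours of a given vertex have the same color. -/
theorem LeavesSameColor.exists_color_neighborSet (hc : T.LeavesSameColor G c) (hT : T.IsTree)
    {x y : V} (hxy : x ≠ y) (hx : T.IsLeafVertex x) (hy : T.IsLeafVertex y)
    (hxy' : ¬ T.Adj x y) (hdeg : ∀ w, Nat.card V ≤ (G.neighborSet w).ncard) (p : W) :
    ∃ κ : α, ∃ F : Set W, F.ncard ≤ Nat.card V ∧ ∀ w, G.Adj p w → w ∉ F → c w = κ := by
  classical
  obtain ⟨z, hz⟩ := Set.ncard_eq_one.mp hy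
  have hyz : ∀ v, T.Adj y v ↔ v = z := fun v => by
    rw [← mem_neighborSet, hz, Set.mem_singleton_iff]
  obtain ⟨f, hfz, -⟩ := hT.exists_copy_of_le_ncard_neighborSet_inter (G := G) z
    (fun _ => Set.univ) p (Set.mem_univ _) le_rfl (fun v v' _ _ w _ => by simpa using hdeg w)
  refine ⟨c (f x), Set.range f, ?_, fun w hpw hwf => ?_⟩
  · rw [← Set.image_univ, ← Set.ncard_univ]; exact Set.ncard_image_le
  -- Re-routing the leaf `y` to `w` gives another copy, in which the leaf `x` keeps its image and
  -- hence dictates the color of `w`.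
  let g : V → W := Function.update f y w
  have gy : g y = w := Function.update_self ..
  have gne : ∀ v, v ≠ y → g v = f v := fun v hv => Function.update_of_ne hv ..
  have hinj : Function.Injective g := by
    intro u v huv
    by_cases hu : u = y <;> by_cases hv : v = y
    · rw [hu, hv]
    · rw [hu, gy, gne v hv] at huv
      exact (hwf ⟨_, huv.symm⟩).elim
    · rw [hv, gy, gne u hu] at huv
      exact (hwf ⟨_, huv⟩).elim
    · rw [gne u hu, gne v hv] at huv
      exact f.injective huv
  have hhom : ∀ {u v}, T.Adj u v → G.Adj (g u) (g v) := by
    intro u v huv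
    by_cases hu : u = y <;> by_cases hv : v = y
    · exact (huv.ne (hu.trans hv.symm)).elim
    · subst hu
      obtain rfl := (hyz v).1 huv
      rw [gy, gne v hv, hfz]
      exact hpw.symm
    · subst hv
      obtain rfl := (hyz u).1 huv.symm
      rw [gy, gne u hu, hfz]
      exact hpw
    · rw [gne u hu, gne v hv]
      exact f.toHom.map_adj huv
  have := hc ⟨⟨g, hhom⟩, hinj⟩ y x hy hx
  change c (g y) = c (g x) at this
  rwa [gy, gne x hxy] at this

/-- If all but few vertices have one of two colors, then a vertex outside the two color classes has
few neighbours in each of them. -/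
theorem LeavesSameColor.ncard_neighborSet_inter_lt (hc : T.LeavesSameColor G c) (hT : T.IsTree)
    (χ : T.Coloring (Fin 2)) {x y : V} (hxy : x ≠ y) (hx : T.IsLeafVertex x)
    (hy : T.IsLeafVertex y) (hχ : χ x = χ y) {ρ β : α}
    (hdeg : ∀ w, Nat.card V + {w | c w ≠ ρ ∧ c w ≠ β}.ncard ≤ (G.neighborSet w).ncard)
    {w : W} (hwβ : c w ≠ β) :
    (G.neighborSet w ∩ {v | c v = ρ}).ncard < Nat.card V := by
  classical
  by_contra! hlarge
  -- Stated for variable colors so that it serves both orders of the pair `ρ`, `β`.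
  have key : ∀ ρ' β', {w | c w ≠ ρ' ∧ c w ≠ β'}.ncard = {w | c w ≠ ρ ∧ c w ≠ β}.ncard →
      ∀ u, c u = β' → Nat.card V ≤ (G.neighborSet u ∩ {v | c v = ρ'}).ncard := by
    intro ρ' β' hX u hu
    have hsub : G.neighborSet u ⊆
        (G.neighborSet u ∩ {v | c v = ρ'}) ∪ {w | c w ≠ ρ' ∧ c w ≠ β'} := by
      intro v hv
      by_cases hvρ : c v = ρ'
      · exact Or.inl ⟨hv, hvρ⟩
      · exact Or.inr ⟨hvρ, fun hvβ => c.valid hv (hu.trans hvβ.symm)⟩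
    have h1 := Set.ncard_le_ncard hsub (Set.toFinite _)
    have h2 := Set.ncard_union_le (G.neighborSet u ∩ {v | c v = ρ'}) {w | c w ≠ ρ' ∧ c w ≠ β'}
    have h3 := hdeg u
    omega
  -- The leaf `y` goes to `w`, the rest of its side of `T` to color `β` and the other side to `ρ`.
  -- The leaf `x` then has color `β`, unlike `w`.
  let S : V → Set W := fun v =>
    if v = y then {w} else if χ v = χ y then {u | c u = β} else {u | c u = ρ}
  obtain ⟨f, hfy, hfS⟩ := hT.exists_copy_of_le_ncard_neighborSet_inter (G := G) y S w
    (by simp [S]) le_rfl (by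
      intro v v' hvv' hv'y u hu
      by_cases hvy : v = y
      · subst hvy
        have hne : χ v' ≠ χ v := (χ.valid hvv').symm
        simp only [S, if_true, Set.mem_singleton_iff] at hu
        simpa only [S, if_neg hv'y, if_neg hne, hu] using hlarge
      · by_cases hcol : χ v = χ y
        · have hne : χ v' ≠ χ y := fun h => χ.valid hvv' (hcol.trans h.symm)
          simp only [S, if_neg hvy, if_pos hcol] at hu
          simp only [S, if_neg hv'y, if_neg hne]
          exact key ρ β rfl u hu
        · have heq : χ v' = χ y := by
            have := χ.valid hvv'
            omega
          simp only [S, if_neg hvy, if_neg hcol] at hu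
          simp only [S, if_neg hv'y, if_pos heq]
          exact key β ρ (by simp only [and_comm]) u hu)
  have hfx := hfS x
  simp only [S, if_neg hxy, if_pos hχ] at hfx
  have := hc f y x hy hx
  rw [hfy, show c (f x) = β from hfx] at this
  exact hwβ this

/-- A large graph of minimum degree at least `⌊n / 2⌋` with a proper coloring in which all leaves of
every copy of `T` have the same color is bipartite. -/
theorem LeavesSameColor.isBipartite [Nontrivial V] (hc : T.LeavesSameColor G c) (hT : T.IsTree)
    (χ : T.Coloring (Fin 2))
    (hχ : ∀ u v : V, T.IsLeafVertex u → T.IsLeafVertex v → χ u = χ v)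
    (hW : 10 * Nat.card V + 10 ≤ Nat.card W)
    (hdeg : ∀ w, Nat.card W / 2 ≤ (G.neighborSet w).ncard) : G.IsBipartite := by
  classical
  obtain ⟨x, y, hxy, hx, hy⟩ := hT.exists_ne_isLeafVertex
  have hχxy := hχ x y hx hy
  have hnadj : ¬ T.Adj x y := fun h => χ.valid h hχxy
  have hclass : ∀ p, ∃ κ : α, Nat.card W / 2 - Nat.card V ≤
      (G.neighborSet p ∩ {w | c w = κ}).ncard := by
    intro p
    obtain ⟨κ, F, hF, hκ⟩ := hc.exists_color_neighborSet hT hxy hx hy hnadj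
      (fun w => by have := hdeg w; omega) p
    refine ⟨κ, ?_⟩
    have hsub : G.neighborSet p ⊆ (G.neighborSet p ∩ {w | c w = κ}) ∪ F := by
      intro w hw
      by_cases hwF : w ∈ F
      · exact Or.inr hwF
      · exact Or.inl ⟨hw, hκ w hw hwF⟩
    have h1 := Set.ncard_le_ncard hsub (Set.toFinite _)
    have h2 := Set.ncard_union_le (G.neighborSet p ∩ {w | c w = κ}) F
    have h3 := hdeg p
    omega
  have hpos : 0 < Nat.card W := by omega
  obtain ⟨⟨p⟩, -⟩ := Nat.card_pos_iff.1 hpos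
  obtain ⟨ρ, hρ⟩ := hclass p
  obtain ⟨r, hpr, hr⟩ := Set.nonempty_of_ncard_ne_zero
    (s := G.neighborSet p ∩ {w | c w = ρ}) (by omega)
  obtain ⟨β, hβ⟩ := hclass r
  obtain ⟨b, hrb, hb⟩ := Set.nonempty_of_ncard_ne_zero
    (s := G.neighborSet r ∩ {w | c w = β}) (by omega)
  have hρβ : ρ ≠ β := fun h => c.valid hrb (hr.trans (h.trans hb.symm))
  -- Each of the two disjoint classes has at least `⌊n/2⌋ - |V|` vertices; the extra 1 is for odd
  -- `n`.
  have hX : {w | c w ≠ ρ ∧ c w ≠ β}.ncard ≤ 2 * Nat.card V + 1 := by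
    have h1 : (G.neighborSet p ∩ {w | c w = ρ}).ncard ≤ {w | c w = ρ}.ncard :=
      Set.ncard_le_ncard Set.inter_subset_right (Set.toFinite _)
    have h2 : (G.neighborSet r ∩ {w | c w = β}).ncard ≤ {w | c w = β}.ncard :=
      Set.ncard_le_ncard Set.inter_subset_right (Set.toFinite _)
    have h3 := Set.ncard_union_eq (s := {w | c w = ρ}) (t := {w | c w = β})
      (Set.disjoint_left.2 fun w h h' => hρβ (Eq.trans (Eq.symm h) h'))
      (Set.toFinite _) (Set.toFinite _)
    have h4 := Set.ncard_add_ncard_compl ({w | c w = ρ} ∪ {w | c w = β})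
    have h5 : ({w | c w = ρ} ∪ {w | c w = β})ᶜ = {w | c w ≠ ρ ∧ c w ≠ β} := by
      ext w; simp
    rw [h5] at h4
    omega
  have htwo : ∀ w, c w = ρ ∨ c w = β := by
    intro w
    by_contra! hw
    have h1 := hc.ncard_neighborSet_inter_lt hT χ hxy hx hy hχxy (ρ := ρ) (β := β)
      (fun w => by have := hdeg w; omega) hw.2
    have h2 := hc.ncard_neighborSet_inter_lt hT χ hxy hx hy hχxy (ρ := β) (β := ρ)
      (fun w => by simp only [and_comm (a := _ ≠ β)]; have := hdeg w; omega) hw.1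
    have hsub : G.neighborSet w ⊆ ((G.neighborSet w ∩ {v | c v = ρ}) ∪
        (G.neighborSet w ∩ {v | c v = β})) ∪ {w | c w ≠ ρ ∧ c w ≠ β} := by
      intro v hv
      by_cases hvρ : c v = ρ
      · exact Or.inl (Or.inl ⟨hv, hvρ⟩)
      · by_cases hvβ : c v = β
        · exact Or.inl (Or.inr ⟨hv, hvβ⟩)
        · exact Or.inr ⟨hvρ, hvβ⟩
    have h3 := Set.ncard_le_ncard hsub (Set.toFinite _)
    have h4 := Set.ncard_union_le ((G.neighborSet w ∩ {v | c v = ρ}) ∪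
        (G.neighborSet w ∩ {v | c v = β})) {w | c w ≠ ρ ∧ c w ≠ β}
    have h5 := Set.ncard_union_le (G.neighborSet w ∩ {v | c v = ρ})
      (G.neighborSet w ∩ {v | c v = β})
    have h6 := hdeg w
    omega
  refine ⟨Coloring.mk (fun w => if c w = ρ then 0 else 1) fun {u v} huv h => c.valid huv ?_⟩
  by_cases hu : c u = ρ <;> by_cases hv : c v = ρ
  · exact hu.trans hv.symm
  · simp [hu, hv] at h
  · simp [hu, hv] at h
  · exact ((htwo u).resolve_left hu).trans ((htwo v).resolve_left hv).symm

end MinDegree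

/-! ### The upper bound by vertex deletion -/

theorem IsBipartite.ncard_edgeSet_le {W : Type*} [Finite W] {G : SimpleGraph W}
    (h : G.IsBipartite) : G.edgeSet.ncard ≤ Nat.card W ^ 2 / 4 := by
  have := h.four_mul_encard_edgeSet_le
  rw [ENat.card_eq_coe_natCard, ← (Set.toFinite G.edgeSet).cast_ncard_eq] at this
  have : 4 * G.edgeSet.ncard ≤ Nat.card W ^ 2 := by exact_mod_cast this
  omega

theorem LeavesSameColor.comp_embedding {V W W' α : Type*} {T : SimpleGraph V} {G : SimpleGraph W}
    {G' : SimpleGraph W'} {c : G.Coloring α} (hc : T.LeavesSameColor G c) (e : G' ↪g G) :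
    T.LeavesSameColor G' (c.comp e.toHom) :=
  fun f => hc (e.toCopy.comp f)

theorem ncard_edgeSet_induce_compl_singleton {W : Type*} [Finite W] (G : SimpleGraph W) (w : W) :
    (G.induce {w}ᶜ).edgeSet.ncard = G.edgeSet.ncard - (G.neighborSet w).ncard := by
  classical
  have := Fintype.ofFinite W
  have h1 := G.card_edgeFinset_induce_compl_singleton w
  rw [card_edgeFinset_deleteIncidenceSet] at h1
  rw [← coe_edgeFinset, ← coe_edgeFinset, Set.ncard_coe_finset, Set.ncard_coe_finset, h1,
    ← card_neighborSet_eq_degree, ← Nat.card_eq_fintype_card, Nat.card_coe_set_eq]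

theorem ncard_edgeSet_le_sq {W : Type*} [Finite W] (G : SimpleGraph W) :
    G.edgeSet.ncard ≤ Nat.card W ^ 2 := by
  classical
  have := Fintype.ofFinite W
  rw [← coe_edgeFinset, Set.ncard_coe_finset, Nat.card_eq_fintype_card]
  refine G.card_edgeFinset_le_card_choose_two.trans (Nat.choose_le_pow _ _)

/-- Deleting a vertex of degree below `⌊n/2⌋` costs at most `⌊n/2⌋ - 1` edges, one less than the
increment of `⌊n²/4⌋`. Each deletion thus gains one edge, which the error term records. Below `m`
vertices the trivial bound by `m ^ 2` suffices. -/
theorem LeavesSameColor.ncard_edgeSet_le_add {V W α : Type*} [Finite V] [Nontrivial V] [Finite W]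
    {T : SimpleGraph V} {G : SimpleGraph W} {c : G.Coloring α} (hc : T.LeavesSameColor G c)
    (hT : T.IsTree) (χ : T.Coloring (Fin 2))
    (hχ : ∀ u v : V, T.IsLeafVertex u → T.IsLeafVertex v → χ u = χ v) {m : ℕ}
    (hm : 10 * Nat.card V + 10 ≤ m) :
    G.edgeSet.ncard ≤ Nat.card W ^ 2 / 4 + (m ^ 2 + m - Nat.card W) := by
  induction hn : Nat.card W generalizing W with
  | zero =>
    have := ncard_edgeSet_le_sq G
    simp_all
  | succ n ih =>
    by_cases hnm : n + 1 < m
    · have h1 := ncard_edgeSet_le_sq G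
      have h2 : (n + 1) ^ 2 ≤ m ^ 2 := Nat.pow_le_pow_left hnm.le 2
      rw [hn] at h1
      omega
    by_cases hdeg : ∀ w, Nat.card W / 2 ≤ (G.neighborSet w).ncard
    · have := (hc.isBipartite hT χ hχ (by omega) hdeg).ncard_edgeSet_le
      rw [hn] at this
      omega
    push Not at hdeg
    obtain ⟨w, hw⟩ := hdeg
    have hcard : Nat.card ({w}ᶜ : Set W) = n := by
      have := Set.ncard_add_ncard_compl ({w} : Set W)
      rw [Set.ncard_singleton, hn] at this
      rw [Nat.card_coe_set_eq]; omega
    have h1 := ih (hc.comp_embedding (Embedding.induce {w}ᶜ)) hcard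
    rw [ncard_edgeSet_induce_compl_singleton] at h1
    have h2 : n ^ 2 / 4 + (n + 1) / 2 = (n + 1) ^ 2 / 4 := by
      rcases Nat.even_or_odd' n with ⟨q, rfl | rfl⟩
      · have h3 : (2 * q) ^ 2 = 4 * q ^ 2 := by ring
        have h4 : (2 * q + 1) ^ 2 = 4 * (q ^ 2 + q) + 1 := by ring
        omega
      · have h3 : (2 * q + 1 + 1) ^ 2 = 4 * (q ^ 2 + 2 * q + 1) := by ring
        have h4 : (2 * q + 1) ^ 2 = 4 * (q ^ 2 + q) + 1 := by ring
        omega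
    rw [hn] at hw
    omega

/-! ### The complete bipartite graph -/

/-- Any two proper 2-colorings of a connected graph induce the same partition. -/
theorem Preconnected.coloring_eq_iff {V : Type*} {T : SimpleGraph V} (hT : T.Preconnected)
    (χ : T.Coloring (Fin 2)) (c : T.Coloring Bool) (u v : V) : χ u = χ v ↔ c u = c v := by
  obtain ⟨p⟩ := hT u v
  induction p with
  | nil => simp
  | cons h p ih =>
    have h1 := χ.valid h
    have h2 := c.valid h
    have hfin : ∀ i j k : Fin 2, i ≠ j → (i = k ↔ j ≠ k) := by decide
    have hbool : ∀ i j k : Bool, i ≠ j → (i = k ↔ j ≠ k) := by decide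
    rw [hfin _ _ _ h1, hbool _ _ _ h2, not_iff_not]
    exact ih

/-- A copy of `T` pulls the bicoloring back to a proper 2-coloring of `T`, which induces the same
partition as `χ`. -/
theorem leavesSameColor_completeBipartiteGraph {V A B α : Type*} {T : SimpleGraph V}
    (hT : T.Preconnected) (χ : T.Coloring (Fin 2))
    (hχ : ∀ u v : V, T.IsLeafVertex u → T.IsLeafVertex v → χ u = χ v) (g : Bool ↪ α) :
    T.LeavesSameColor (completeBipartiteGraph A B) (c := (Embedding.completeGraph g).toHom.comp
      (CompleteBipartiteGraph.bicoloring A B)) := by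
  intro f u v hu hv
  exact congrArg g ((hT.coloring_eq_iff χ
    ((CompleteBipartiteGraph.bicoloring A B).comp f.toHom) u v).1 (hχ u v hu hv))

theorem ncard_edgeSet_completeBipartiteGraph (a b : ℕ) :
    (completeBipartiteGraph (Fin a) (Fin b)).edgeSet.ncard = a * b := by
  have h := encard_edgeSet_completeBipartiteGraph (W₁ := Fin a) (W₂ := Fin b)
  rw [← (Set.toFinite _).cast_ncard_eq] at h
  simp only [ENat.card_eq_coe_fintype_card, Fintype.card_fin] at h
  exact_mod_cast h

end SimpleGraph

/-! ### Rounding, and the main theorem -/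

theorem Nat.floor_sq_div_four (n : ℕ) : ⌊(n : ℝ) ^ 2 / 4⌋₊ = n ^ 2 / 4 := by
  have := Nat.floor_div_eq_div (K := ℝ) (n ^ 2) 4
  push_cast at this
  exact this

theorem Nat.floor_half (n : ℕ) : ⌊(n : ℝ) / 2⌋₊ = n / 2 := by
  have := Nat.floor_div_eq_div (K := ℝ) n 2
  push_cast at this
  exact this

theorem Nat.ceil_half (n : ℕ) : ⌈(n : ℝ) / 2⌉₊ = n - n / 2 := by
  rcases Nat.even_or_odd' n with ⟨q, rfl | rfl⟩
  · have h : ((2 * q : ℕ) : ℝ) / 2 = (q : ℕ) := by push_cast; ring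
    rw [h, Nat.ceil_natCast]
    omega
  · have h : 2 * q + 1 - (2 * q + 1) / 2 = q + 1 := by omega
    rw [h, Nat.ceil_eq_iff (by omega)]
    push_cast
    constructor <;> linarith

open SimpleGraph in
theorem mainTheorem3 {V : Type*} [Finite V] [Nontrivial V] (T : SimpleGraph V) (hT : T.IsTree)
    (χ : T.Coloring (Fin 2))
    (hχ : ∀ u v : V, T.IsLeafVertex u → T.IsLeafVertex v → χ u = χ v) :
    ∃ N : ℕ, ∀ n : ℕ, N ≤ n →
      T.coloredExtremalNumber n = ⌊(n : ℝ) ^ 2 / 4⌋₊ ∧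
      (∃ c : (completeBipartiteGraph (Fin ⌊(n : ℝ) / 2⌋₊) (Fin ⌈(n : ℝ) / 2⌉₊)).Coloring ℕ,
        T.LeavesSameColor
          (completeBipartiteGraph (Fin ⌊(n : ℝ) / 2⌋₊) (Fin ⌈(n : ℝ) / 2⌉₊)) c) ∧
      (completeBipartiteGraph (Fin ⌊(n : ℝ) / 2⌋₊) (Fin ⌈(n : ℝ) / 2⌉₊)).edgeSet.ncard =
        ⌊(n : ℝ) ^ 2 / 4⌋₊ := by
  obtain ⟨m, hm⟩ : ∃ m, 10 * Nat.card V + 10 = m := ⟨_, rfl⟩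
  -- From this `n` on, the truncated error term `m ^ 2 + m - n` vanishes.
  refine ⟨m ^ 2 + m, fun n hn => ?_⟩
  rw [Nat.floor_sq_div_four, Nat.floor_half, Nat.ceil_half]
  have hedges : n / 2 * (n - n / 2) = n ^ 2 / 4 := by
    rcases Nat.even_or_odd' n with ⟨q, rfl | rfl⟩
    · have h1 : 2 * q / 2 = q := by omega
      have h2 : 2 * q - q = q := by omega
      have h3 : (2 * q) ^ 2 = 4 * (q * q) := by ring
      rw [h1, h2]; omega
    · have h1 : (2 * q + 1) / 2 = q := by omega
      have h2 : 2 * q + 1 - q = q + 1 := by omega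
      have h3 : (2 * q + 1) ^ 2 = 4 * (q * (q + 1)) + 1 := by ring
      rw [h1, h2]; omega
  have hcol := leavesSameColor_completeBipartiteGraph (A := Fin (n / 2)) (B := Fin (n - n / 2))
    hT.connected.preconnected χ hχ (⟨Bool.toNat, by decide⟩ : Bool ↪ ℕ)
  have hcount : (completeBipartiteGraph (Fin (n / 2)) (Fin (n - n / 2))).edgeSet.ncard =
      n ^ 2 / 4 := (ncard_edgeSet_completeBipartiteGraph _ _).trans hedges
  refine ⟨?_, ⟨_, hcol⟩, hcount⟩
  have hmax := SimpleGraph.isGreatest_coloredExtremalNumber n T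
  apply le_antisymm
  · obtain ⟨G, c, hc, hG⟩ := hmax.1
    have := hc.ncard_edgeSet_le_add hT χ hχ hm.le
    rw [hG, Nat.card_fin] at this
    omega
  · let φ : Fin (n / 2) ⊕ Fin (n - n / 2) ≃ Fin n :=
      finSumFinEquiv.trans (finCongr (by omega))
    let K := completeBipartiteGraph (Fin (n / 2)) (Fin (n - n / 2))
    let e : K.map φ.toEmbedding ≃g K := (Iso.map φ K).symm
    refine hmax.2 ⟨K.map φ.toEmbedding, _, hcol.comp_embedding e.toEmbedding, ?_⟩
    rw [← hcount, ← Nat.card_coe_set_eq, ← Nat.card_coe_set_eq]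
    exact Nat.card_congr e.mapEdgeSet
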